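/- Let $H$ be a finite-dimensional complex Hilbert space and $B(H)$ the algebra of linear operators on $H$. Let $\mathcal C(B(H))$ be the set of commutative von Neumann subalgebras of $B(H)$, that is, of commutative $*$-subalgebras closed in the weak operator topology, whose unit is not required to be $\mathrm{id}_H$. Let $\mathrm{KSub}(H)$ be the lattice of kernel subobjects of $H$ in the category of finite-dimensional Hilbert spaces, that is, of linear subspaces $k \colon K \hookrightarrow H$, ordered by inclusion. A classical structure on $H$ is a linear map $\delta \colon H \to H \otimes H$ with $(\delta\otimes\mathrm{id})\circ\delta=(\mathrm{id}\otimes\delta)\circ\delta$ (up to the associativity isomorphism), $\sigma\circ\delta=\delta$ for the swap $\sigma$, $\delta^\dagger\circ\delta=\mathrm{id}$, and such that there is an involution $x\mapsto x^*$ on the linear maps $\mathbb C\to H$ with $\delta^\dagger\circ(x^*\otimes\mathrm{id})=(x^\dagger\otimes\mathrm{id})\circ\delta$ for all $x$. A kernel $k$ is copyable along $\delta$ if $P(k)=k\circ k^\dagger$ satisfies $\delta\circ P(k)=(P(k)\otimes P(k))\circ\delta$. Then there is a bijection $$\mathcal C(B(H)) \;\cong\; \bigl\{ (k_i)_{i\in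 I} \;\bigm|\; k_i\in \mathrm{KSub}(H)\setminus\{0\},\ k_i\wedge k_j=0 \text{ for } i\neq j,\ \exists\, \delta\colon H\to H\otimes H \text{ a classical structure such that every } k_i \text{ is copyable along } \delta \bigr\},$$ where families are considered up to reindexing (equivalently, as sets of kernels). It sends $C$ to the set of atoms (minimal nonzero elements) of its lattice of projections $\{k\in\mathrm{KSub}(H) \mid P(k)\in C\}$. Under it, the algebras $C$ that contain $\mathrm{id}_H$ correspond to the families with $\bigvee_i k_i=H$. -/

import Mathlib

open scoped TensorProduct

/-! Finite-dimensional Hilbert spaces `H` and linear maps between them (category `fdHilb`).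
The dagger is the adjoint, the monoidal product is `⊗[ℂ]` with its Hilbert space structure,
and the monoidal unit is `ℂ`. -/

section FdHilb

variable {H : Type*} [NormedAddCommGroup H] [InnerProductSpace ℂ H] [FiniteDimensional ℂ H]

/-- A classical structure on `H`: a cocommutative cosemigroup `δ : H → H ⊗ H` with `δ† ∘ δ = id`
that satisfies the H*-axiom: there is an involution `*` on the morphisms `ℂ → H` such that
`δ† ∘ (x* ⊗ id) = (x† ⊗ id) ∘ δ`, up to the unit isomorphism `ℂ ⊗ H ≅ H`. -/
structure IsClassicalStructure (δ : H →ₗ[ℂ] H ⊗[ℂ] H) : Prop where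
  coassoc : (TensorProduct.assoc ℂ H H H).toLinearMap ∘ₗ TensorProduct.map δ LinearMap.id ∘ₗ δ =
    TensorProduct.map LinearMap.id δ ∘ₗ δ
  cocomm : (TensorProduct.comm ℂ H H).toLinearMap ∘ₗ δ = δ
  isometry : LinearMap.adjoint δ ∘ₗ δ = LinearMap.id
  hstar : ∃ s : (ℂ →ₗ[ℂ] H) → (ℂ →ₗ[ℂ] H), Function.Involutive s ∧
    ∀ x : ℂ →ₗ[ℂ] H,
      LinearMap.adjoint δ ∘ₗ TensorProduct.map (s x) LinearMap.id ∘ₗ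
          (TensorProduct.lid ℂ H).symm.toLinearMap =
        (TensorProduct.lid ℂ H).toLinearMap ∘ₗ
          TensorProduct.map (LinearMap.adjoint x) LinearMap.id ∘ₗ δ

/-- The endomorphism `P(k) = k ∘ k†` of `H` associated with a morphism `k : K → H`. -/
noncomputable def kernelProj {K : Type*} [NormedAddCommGroup K] [InnerProductSpace ℂ K]
    [FiniteDimensional ℂ K] (k : K →ₗ[ℂ] H) : H →ₗ[ℂ] H :=
  k ∘ₗ LinearMap.adjoint k

/-- An endomorphism `p` of `H` is copyable along `δ` when `δ ∘ p = (p ⊗ p) ∘ δ`. -/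
def IsCopyableEnd (δ : H →ₗ[ℂ] H ⊗[ℂ] H) (p : H →ₗ[ℂ] H) : Prop :=
  δ ∘ₗ p = TensorProduct.map p p ∘ₗ δ

/-- A morphism `k : K → H` is copyable along `δ` when the endomorphism `P(k) = k ∘ k†` is. -/
def IsCopyable {K : Type*} [NormedAddCommGroup K] [InnerProductSpace ℂ K]
    [FiniteDimensional ℂ K] (δ : H →ₗ[ℂ] H ⊗[ℂ] H) (k : K →ₗ[ℂ] H) : Prop :=
  IsCopyableEnd δ (kernelProj k)

variable (H) in
/-- The kernel subobjects of `H` in `fdHilb`. The kernel of a morphism `f` out of `H` is the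
inclusion `ker f → H`, a dagger monic, and every linear subspace of `H` is of this form
(`KSub.exists_ker_eq`); so a kernel subobject is a linear subspace `K`, standing for its
inclusion `K.subtype : K → H`. The order is inclusion and the meet is intersection. -/
abbrev KSub : Type _ := Submodule ℂ H

theorem KSub.exists_ker_eq (K : KSub H) : ∃ f : H →ₗ[ℂ] H, LinearMap.ker f = K := by
  refine ⟨Kᗮ.starProjection.toLinearMap, ?_⟩
  ext x
  rw [LinearMap.mem_ker]
  change Kᗮ.starProjection x = 0 ↔ x ∈ K
  rw [Submodule.starProjection_apply_eq_zero_iff, Submodule.orthogonal_orthogonal]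

/-- A family of nonzero kernels of `H` that are pairwise disjoint, `k i ∧ k j = 0` for `i ≠ j`,
and all copyable along one and the same classical structure on `H`. -/
structure IsCopyableKernelFamily {ι : Type*} (k : ι → KSub H) : Prop where
  ne_bot : ∀ i, k i ≠ ⊥
  disjoint : ∀ i j, i ≠ j → k i ⊓ k j = ⊥
  copyable : ∃ δ : H →ₗ[ℂ] H ⊗[ℂ] H, IsClassicalStructure δ ∧
    ∀ i, IsCopyable δ (k i).subtype

end FdHilb

section VonNeumann

variable {H : Type*} [NormedAddCommGroup H] [InnerProductSpace ℂ H] [CompleteSpace H]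

/-- A commutative von Neumann subalgebra of `B(H)`: a commutative *-subalgebra that is closed in
the weak operator topology. Its unit need not be the identity of `H`. -/
structure IsCommVonNeumannSubalgebra (C : NonUnitalStarSubalgebra ℂ (H →L[ℂ] H)) : Prop where
  comm : ∀ a ∈ C, ∀ b ∈ C, a * b = b * a
  closed : IsClosed {T : H →WOT[ℂ] H | T.toCLM ∈ C}

/-- The projections of `C`, as a set of kernel subobjects of `H`: those `k` with `P(k) ∈ C`. -/
def kernelsOf [FiniteDimensional ℂ H] (C : NonUnitalStarSubalgebra ℂ (H →L[ℂ] H)) :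
    Set (KSub H) :=
  {K | LinearMap.toContinuousLinearMap (kernelProj K.subtype) ∈ C}

/-- The atoms of the lattice of projections of `C`: its minimal nonzero elements. -/
def atomsOf [FiniteDimensional ℂ H] (C : NonUnitalStarSubalgebra ℂ (H →L[ℂ] H)) :
    Set (KSub H) :=
  {K | Minimal (fun L : KSub H => L ∈ kernelsOf C ∧ L ≠ ⊥) K}

end VonNeumann

/-! Both sides amount to sets of pairwise orthogonal nonzero subspaces of `H`. Regard `δ†` as a
commutative multiplication on `H`. If a projection `p` is copyable, then `p (xy) = (p x)(p y)`, so
`ker p` is an ideal. By the H*-axiom the adjoint of a multiplication is a multiplication, so the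
complement `range p` is an ideal too, and `p (xy) = x (p y)`. Products span `H` because `δ† ∘ δ =
id`, hence copyable projections commute (`IsCopyableEnd.commute`), and disjoint ones are orthogonal.
Conversely, orthogonal subspaces share an adapted orthonormal basis, and copying its vectors is a
classical structure along which all of them are copyable. On the algebra side, the spectral theorem
makes `C` the span of its projections, and each projection is a sum of atoms. Atoms are pairwise
orthogonal, so `C` is recovered as the span of its atoms; `spanProjections` is the inverse map. -/

section OrthonormalBasis

variable {H : Type*} [NormedAddCommGroup H] [InnerProductSpace ℂ H]

/-- The linear map that copies the vectors of an orthonormal basis. -/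
noncomputable def copyMap {ι : Type*} [Fintype ι] (b : OrthonormalBasis ι ℂ H) :
    H →ₗ[ℂ] H ⊗[ℂ] H :=
  b.toBasis.constr ℂ fun i => b i ⊗ₜ b i

@[simp]
theorem copyMap_apply_basis {ι : Type*} [Fintype ι] (b : OrthonormalBasis ι ℂ H) (i : ι) :
    copyMap b (b i) = b i ⊗ₜ b i := by
  have := b.toBasis.constr_basis ℂ (fun i => b i ⊗ₜ[ℂ] b i) i
  rwa [b.coe_toBasis] at this

theorem OrthonormalBasis.linearMap_ext {ι : Type*} [Fintype ι] (b : OrthonormalBasis ι ℂ H)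
    {M : Type*} [AddCommGroup M] [Module ℂ M] {f g : H →ₗ[ℂ] M} (h : ∀ i, f (b i) = g (b i)) :
    f = g :=
  b.toBasis.ext fun i => by simpa using h i

/-- The coordinatewise complex conjugation in an orthonormal basis. -/
noncomputable def basisConj {ι : Type*} [Fintype ι] (b : OrthonormalBasis ι ℂ H) (v : H) : H :=
  ∑ i, inner ℂ v (b i) • b i

theorem inner_basisConj {ι : Type*} [Fintype ι] (b : OrthonormalBasis ι ℂ H) (v : H) (i : ι) :
    inner ℂ (b i) (basisConj b v) = inner ℂ v (b i) := by
  exact b.orthonormal.inner_right_fintype _ i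

theorem basisConj_involutive {ι : Type*} [Fintype ι] (b : OrthonormalBasis ι ℂ H) :
    Function.Involutive (basisConj b) := fun v => by
  refine b.repr.injective ?_
  ext i
  rw [b.repr_apply_apply, b.repr_apply_apply, inner_basisConj, ← inner_conj_symm, inner_basisConj, inner_conj_symm]

theorem isCopyableEnd_copyMap {ι : Type*} [Fintype ι] (b : OrthonormalBasis ι ℂ H)
    {p : H →ₗ[ℂ] H} (h : ∀ i, p (b i) = 0 ∨ p (b i) = b i) : IsCopyableEnd (copyMap b) p :=
  b.linearMap_ext fun i => by
    rcases h i with h | h <;> simp [h]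

end OrthonormalBasis

/-! ### Classical structures as multiplications, and commutation of copyable projections. -/

section Copyable

variable {H : Type*} [NormedAddCommGroup H] [InnerProductSpace ℂ H] [FiniteDimensional ℂ H]

theorem toContinuousLinearMap_kernelProj_subtype [CompleteSpace H] (K : Submodule ℂ H) :
    LinearMap.toContinuousLinearMap (kernelProj K.subtype) = K.starProjection := by
  have h : LinearMap.adjoint K.subtype = K.orthogonalProjectionOnto.toLinearMap := by
    symm
    rw [LinearMap.eq_adjoint_iff]
    intro x y
    simp
  ext x
  rw [Submodule.starProjection_apply]
  simp [kernelProj, h]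

theorem kernelProj_subtype_apply (K : Submodule ℂ H) (x : H) :
    kernelProj K.subtype x = K.starProjection x := by
  have : CompleteSpace H := FiniteDimensional.complete ℂ H
  exact congrArg (fun T : H →L[ℂ] H => T x) (toContinuousLinearMap_kernelProj_subtype K)

theorem IsClassicalStructure.adjoint_tmul_comm {δ : H →ₗ[ℂ] H ⊗[ℂ] H}
    (hδ : IsClassicalStructure δ) (x y : H) :
    LinearMap.adjoint δ (x ⊗ₜ y) = LinearMap.adjoint δ (y ⊗ₜ x) := by
  refine ext_inner_right ℂ fun z => ?_
  rw [LinearMap.adjoint_inner_left, LinearMap.adjoint_inner_left,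
    ← TensorProduct.inner_comm_comm, TensorProduct.comm_tmul]
  exact congrArg _ (LinearMap.congr_fun hδ.cocomm z)

/-- Multiplication by `v` has an adjoint that is again a multiplication. -/
theorem IsClassicalStructure.exists_adjoint_mul {δ : H →ₗ[ℂ] H ⊗[ℂ] H}
    (hδ : IsClassicalStructure δ) (v : H) :
    ∃ w : H, ∀ y z, inner ℂ (LinearMap.adjoint δ (w ⊗ₜ y)) z =
      inner ℂ y (LinearMap.adjoint δ (v ⊗ₜ z)) := by
  obtain ⟨s, -, hs⟩ := hδ.hstar
  set x := LinearMap.toSpanSingleton ℂ H v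
  refine ⟨s x 1, fun y z => ?_⟩
  have h := LinearMap.congr_fun (hs x) y
  simp only [LinearMap.comp_apply, LinearEquiv.coe_coe, TensorProduct.lid_symm_apply,
    TensorProduct.map_tmul, LinearMap.id_apply] at h
  rw [h, LinearMap.adjoint_inner_right]
  have key : ∀ t : H ⊗[ℂ] H, inner ℂ (TensorProduct.lid ℂ H
      (TensorProduct.map (LinearMap.adjoint x) LinearMap.id t)) z = inner ℂ t (v ⊗ₜ z) := by
    intro t
    induction t with
    | zero => simp
    | add a b ha hb => simp only [map_add, inner_add_left, ha, hb]
    | tmul a b =>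
      have : inner ℂ a v = starRingEnd ℂ (LinearMap.adjoint x a) := by
        have := LinearMap.adjoint_inner_left x 1 a
        simpa [x] using this.symm
      simp [this, mul_comm]
  exact key _

theorem IsCopyableEnd.adjoint_tmul {δ : H →ₗ[ℂ] H ⊗[ℂ] H} {p : H →ₗ[ℂ] H}
    (hp : p.IsSymmetric) (h : IsCopyableEnd δ p) (x y : H) :
    p (LinearMap.adjoint δ (x ⊗ₜ y)) = LinearMap.adjoint δ (p x ⊗ₜ p y) := by
  refine ext_inner_right ℂ fun z => ?_
  have key : ∀ t : H ⊗[ℂ] H, inner ℂ (x ⊗ₜ y) (TensorProduct.map p p t) =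
      inner ℂ (p x ⊗ₜ[ℂ] p y) t := by
    intro t
    induction t with
    | zero => simp
    | add a b ha hb => simp only [map_add, inner_add_right, ha, hb]
    | tmul a b => simp [hp x a, hp y b]
  rw [hp, LinearMap.adjoint_inner_left, LinearMap.adjoint_inner_left, ← key]
  exact congrArg _ (LinearMap.congr_fun h z)

/-- A copyable projection is a module map for the multiplication adjoint to `δ`. -/
theorem IsCopyableEnd.apply_adjoint_tmul_right {δ : H →ₗ[ℂ] H ⊗[ℂ] H} {p : H →ₗ[ℂ] H}
    (hδ : IsClassicalStructure δ) (hp : p.IsSymmetricProjection) (h : IsCopyableEnd δ p)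
    (w y : H) :
    p (LinearMap.adjoint δ (w ⊗ₜ y)) = LinearMap.adjoint δ (w ⊗ₜ p y) := by
  have hpp : ∀ x, p (p x) = p x := fun x => LinearMap.congr_fun hp.isIdempotentElem x
  -- The kernel of `p` is an ideal.
  have hker : ∀ w n, p n = 0 → p (LinearMap.adjoint δ (w ⊗ₜ n)) = 0 := fun w n hn => by
    rw [h.adjoint_tmul hp.isSymmetric, hn, TensorProduct.tmul_zero, map_zero]
  -- So is its orthogonal complement, the range: multiplication by `w` is adjoint to multiplication
  -- by `w'`, which preserves the kernel.
  have hran : p (LinearMap.adjoint δ (w ⊗ₜ p y)) = LinearMap.adjoint δ (w ⊗ₜ p y) := by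
    obtain ⟨w', hw'⟩ := hδ.exists_adjoint_mul w
    refine ext_inner_left ℂ fun z => ?_
    have h0 : p (z - p z) = 0 := by rw [map_sub, hpp, sub_self]
    have : inner ℂ (z - p z) (LinearMap.adjoint δ (w ⊗ₜ p y)) = 0 := by
      rw [← hw', ← hp.isSymmetric, hker _ _ h0, inner_zero_left]
    rw [inner_sub_left, sub_eq_zero] at this
    rw [← hp.isSymmetric, this]
  have h0 : p (y - p y) = 0 := by rw [map_sub, hpp, sub_self]
  have := hker w _ h0
  rwa [TensorProduct.tmul_sub, map_sub, map_sub, hran, sub_eq_zero] at this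

/-- On a product `xy` both composites give `(p x)(q y)`, and `δ† ∘ δ = id` makes products span `H`.
-/
theorem IsCopyableEnd.commute {δ : H →ₗ[ℂ] H ⊗[ℂ] H} {p q : H →ₗ[ℂ] H}
    (hδ : IsClassicalStructure δ) (hp : p.IsSymmetricProjection) (hq : q.IsSymmetricProjection)
    (hpδ : IsCopyableEnd δ p) (hqδ : IsCopyableEnd δ q) : p ∘ₗ q = q ∘ₗ p := by
  have h : (p ∘ₗ q) ∘ₗ LinearMap.adjoint δ = (q ∘ₗ p) ∘ₗ LinearMap.adjoint δ := by
    refine TensorProduct.ext' fun x y => ?_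
    simp only [LinearMap.comp_apply]
    rw [hqδ.apply_adjoint_tmul_right hδ hq, hδ.adjoint_tmul_comm,
      hpδ.apply_adjoint_tmul_right hδ hp, hδ.adjoint_tmul_comm x y,
      hpδ.apply_adjoint_tmul_right hδ hp, hδ.adjoint_tmul_comm,
      hδ.adjoint_tmul_comm y (p x), hqδ.apply_adjoint_tmul_right hδ hq]
  have := congrArg (fun f => f ∘ₗ δ) h
  simpa only [LinearMap.comp_assoc, hδ.isometry, LinearMap.comp_id] using this

theorem adjoint_copyMap_tmul {ι : Type*} [Fintype ι] (b : OrthonormalBasis ι ℂ H) (v : H)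
    (j : ι) : LinearMap.adjoint (copyMap b) (v ⊗ₜ b j) = inner ℂ (b j) v • b j := by
  classical
  refine b.repr.injective ?_
  ext i
  rw [b.repr_apply_apply, b.repr_apply_apply, LinearMap.adjoint_inner_right, copyMap_apply_basis,
    TensorProduct.inner_tmul, b.inner_eq_ite, inner_smul_right, b.inner_eq_ite]
  split_ifs with h
  · rw [h]
  · simp

theorem isClassicalStructure_copyMap {ι : Type*} [Fintype ι] (b : OrthonormalBasis ι ℂ H) :
    IsClassicalStructure (copyMap b) where
  coassoc := b.linearMap_ext fun i => by simp
  cocomm := b.linearMap_ext fun i => by simp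
  isometry := b.linearMap_ext fun i => by simp [adjoint_copyMap_tmul]
  hstar := by
    -- Since `δ† (v ⊗ b i) = ⟨b i, v⟩ b i`, the H*-axiom forces the coordinates of `x*` to be the
    -- conjugates of those of `x`.
    refine ⟨fun x => LinearMap.toSpanSingleton ℂ H (basisConj b (x 1)), fun x => ?_, fun x => ?_⟩
    · ext
      simp [basisConj_involutive b (x 1)]
    · refine b.linearMap_ext fun i => ?_
      have : inner ℂ (x 1) (b i) = LinearMap.adjoint x (b i) := by
        simpa using (LinearMap.adjoint_inner_right x 1 (b i)).symm
      simp [adjoint_copyMap_tmul, inner_basisConj, this]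

end Copyable

/-! ### Orthogonal families of subspaces and copyable families. -/

section Projections

variable {H : Type*} [NormedAddCommGroup H] [InnerProductSpace ℂ H] [FiniteDimensional ℂ H]

/-- Disjoint subspaces with commuting projections are orthogonal. -/
theorem Submodule.isOrtho_of_commute_of_inf_eq_bot {K L : Submodule ℂ H}
    (h : Commute K.starProjection L.starProjection) (hKL : K ⊓ L = ⊥) : K ⟂ L := by
  rw [← Submodule.starProjection_comp_starProjection_eq_zero_iff]
  ext x
  have hK : K.starProjection (L.starProjection x) ∈ K := K.starProjection_apply_mem _
  have hL : K.starProjection (L.starProjection x) ∈ L := by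
    have := congrArg (fun T : H →L[ℂ] H => T x) h.eq
    simp only [mul_apply_eq_comp] at this
    rw [this]
    exact L.starProjection_apply_mem _
  have := Submodule.mem_inf.2 ⟨hK, hL⟩
  rw [hKL, Submodule.mem_bot] at this
  simpa using this

theorem Submodule.starProjection_mul_of_le {K L : Submodule ℂ H} (h : K ≤ L) :
    L.starProjection * K.starProjection = K.starProjection := by
  ext x
  exact L.starProjection_eq_self_iff.2 (h (K.starProjection_apply_mem x))

theorem Submodule.le_of_starProjection_mul {K L : Submodule ℂ H} {c : ℂ} (hc : c ≠ 0)
    (h : L.starProjection * K.starProjection = c • K.starProjection) : K ≤ L := fun x hx => by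
  have := congrArg (fun T : H →L[ℂ] H => T x) h
  simp only [mul_apply_eq_comp, smul_apply,
    K.starProjection_eq_self_iff.2 hx] at this
  have hm := L.starProjection_apply_mem x
  rw [this] at hm
  exact (L.smul_mem_iff hc).1 hm

theorem Submodule.starProjection_ne_zero {K : Submodule ℂ H} (h : K ≠ ⊥) :
    K.starProjection ≠ 0 := fun h0 => h <| by
  rw [Submodule.eq_bot_iff]
  intro x hx
  rw [← K.starProjection_eq_self_iff.2 hx, h0, zero_apply]

theorem isSymmetricProjection_kernelProj_subtype (K : Submodule ℂ H) :
    (kernelProj K.subtype).IsSymmetricProjection := by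
  have : CompleteSpace H := FiniteDimensional.complete ℂ H
  have h := ContinuousLinearMap.IsStarProjection.isSymmetricProjection
    (isStarProjection_starProjection (U := K))
  rwa [← toContinuousLinearMap_kernelProj_subtype] at h

theorem IsCopyableKernelFamily.isOrtho {ι : Type*} {k : ι → KSub H}
    (h : IsCopyableKernelFamily k) {i j : ι} (hij : i ≠ j) : k i ⟂ k j := by
  obtain ⟨δ, hδ, hk⟩ := h.copyable
  refine Submodule.isOrtho_of_commute_of_inf_eq_bot ?_ (h.disjoint i j hij)
  ext x
  have := LinearMap.congr_fun (IsCopyableEnd.commute hδ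
    (isSymmetricProjection_kernelProj_subtype (k i))
    (isSymmetricProjection_kernelProj_subtype (k j)) (hk i) (hk j)) x
  simpa [kernelProj_subtype_apply] using this

/-- Pairwise orthogonal subspaces have an adapted orthonormal basis. -/
theorem exists_orthonormalBasis_adapted {S : Set (Submodule ℂ H)}
    (hS : S.Pairwise fun K L => K ⟂ L) :
    ∃ (u : Finset H) (b : OrthonormalBasis u ℂ H), ∀ K ∈ S, ∀ i,
      K.starProjection (b i) = 0 ∨ K.starProjection (b i) = b i := by
  -- The union of orthonormal bases of all members of `S` is orthonormal and extends to a basis of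
  -- `H`.
  set v : Set H := {x | ∃ K ∈ S, ∃ i, x = stdOrthonormalBasis ℂ K i} with hv
  have hvo : Orthonormal ℂ ((↑) : v → H) := by
    refine ⟨?_, ?_⟩
    · rintro ⟨x, K, hK, i, rfl⟩
      exact (stdOrthonormalBasis ℂ K).orthonormal.1 i
    · rintro ⟨x, K, hK, i, rfl⟩ ⟨y, L, hL, j, rfl⟩ hxy
      by_cases hKL : K = L
      · subst hKL
        have hij : i ≠ j := fun hij => hxy (by rw [hij])
        exact (stdOrthonormalBasis ℂ K).orthonormal.2 hij
      · exact (hS hK hL hKL).inner_eq (stdOrthonormalBasis ℂ K i).2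
          (stdOrthonormalBasis ℂ L j).2
  obtain ⟨u, b, hvu, hb⟩ := hvo.exists_orthonormalBasis_extension
  refine ⟨u, b, fun K hK i => ?_⟩
  by_cases hi : ∃ j, b i = stdOrthonormalBasis ℂ K j
  · obtain ⟨j, hj⟩ := hi
    right
    rw [hj]
    exact K.starProjection_eq_self_iff.2 (stdOrthonormalBasis ℂ K j).2
  · left
    rw [K.starProjection_apply_eq_zero_iff, Submodule.mem_orthogonal]
    intro x hx
    have hsum := (stdOrthonormalBasis ℂ K).sum_repr ⟨x, hx⟩
    have hx' : x = _ := (congrArg Subtype.val hsum).symm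
    rw [hx', Submodule.coe_sum, sum_inner]
    refine Finset.sum_eq_zero fun j _ => ?_
    have hj : (stdOrthonormalBasis ℂ K j : H) ∈ u := hvu ⟨K, hK, j, rfl⟩
    have hbj : b ⟨_, hj⟩ = stdOrthonormalBasis ℂ K j := by rw [hb]
    have hne : (⟨_, hj⟩ : u) ≠ i := fun h => hi ⟨j, by rw [← h, hbj]⟩
    rw [Submodule.coe_smul, inner_smul_left, ← hbj, b.orthonormal.2 hne, mul_zero]

theorem isCopyableKernelFamily_of_pairwise_isOrtho {S : Set (KSub H)}
    (hne : ∀ K ∈ S, K ≠ ⊥) (hS : S.Pairwise fun K L => K ⟂ L) :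
    IsCopyableKernelFamily (fun K : S => (K : KSub H)) where
  ne_bot K := hne K K.2
  disjoint K L hKL := (hS K.2 L.2 fun h => hKL (Subtype.ext h)).disjoint.eq_bot
  copyable := by
    obtain ⟨u, b, hb⟩ := exists_orthonormalBasis_adapted hS
    refine ⟨copyMap b, isClassicalStructure_copyMap b, fun K => ?_⟩
    refine isCopyableEnd_copyMap b fun i => ?_
    rw [kernelProj_subtype_apply]
    exact hb K K.2 i

end Projections

/-! ### Commutative algebras of operators and their atoms. -/

section Algebra

variable {H : Type*} [NormedAddCommGroup H] [InnerProductSpace ℂ H] [CompleteSpace H]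
  [FiniteDimensional ℂ H] {C : NonUnitalStarSubalgebra ℂ (H →L[ℂ] H)}

theorem mem_kernelsOf {K : KSub H} : K ∈ kernelsOf C ↔ K.starProjection ∈ C := by
  rw [kernelsOf, Set.mem_ofPred_eq, toContinuousLinearMap_kernelProj_subtype]

theorem IsStarProjection.exists_eq_starProjection {T : H →L[ℂ] H} (h : IsStarProjection T) :
    ∃ K : Submodule ℂ H, T = K.starProjection := by
  obtain ⟨K, _, h⟩ := isStarProjection_iff_eq_starProjection.1 h
  exact ⟨K, h⟩

theorem minimal_of_mem_atomsOf {K : KSub H} (hK : K ∈ atomsOf C) :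
    Minimal (fun L : KSub H => L ∈ kernelsOf C ∧ L ≠ ⊥) K :=
  hK

namespace IsCommVonNeumannSubalgebra

theorem isClosed_coe (C : NonUnitalStarSubalgebra ℂ (H →L[ℂ] H)) :
    IsClosed (C : Set (H →L[ℂ] H)) :=
  C.toSubmodule.closed_of_finiteDimensional

/-- The product of two commuting projections is the projection onto the intersection. -/
theorem exists_inf {K L : KSub H} (hC : IsCommVonNeumannSubalgebra C) (hK : K ∈ kernelsOf C)
    (hL : L ∈ kernelsOf C) : K ⊓ L ∈ kernelsOf C := by
  rw [mem_kernelsOf] at *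
  have hcomm := hC.comm _ hK _ hL
  have hP : IsStarProjection (K.starProjection * L.starProjection) :=
    isStarProjection_starProjection.mul isStarProjection_starProjection hcomm
  obtain ⟨M, hM⟩ := hP.exists_eq_starProjection
  have : M = K ⊓ L := by
    refine le_antisymm (fun x hx => ?_) fun x hx => ?_
    · have hx' := M.starProjection_eq_self_iff.2 hx
      have h1 := hx'
      rw [← hM] at h1
      have h2 := hx'
      rw [← hM, hcomm] at h2
      exact ⟨h1 ▸ K.starProjection_apply_mem _, h2 ▸ L.starProjection_apply_mem _⟩
    · rw [← M.starProjection_eq_self_iff, ← hM, mul_apply_eq_comp,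
        L.starProjection_eq_self_iff.2 hx.2, K.starProjection_eq_self_iff.2 hx.1]
  rw [← this, ← hM]
  exact C.mul_mem hK hL

/-- A nonzero meet of two atoms would equal both by minimality, so distinct atoms are disjoint;
their projections commute. -/
theorem atoms_isOrtho (hC : IsCommVonNeumannSubalgebra C) :
    (atomsOf C).Pairwise fun K L => K ⟂ L := by
  intro K hK L hL hKL
  replace hK := minimal_of_mem_atomsOf hK
  replace hL := minimal_of_mem_atomsOf hL
  refine Submodule.isOrtho_of_commute_of_inf_eq_bot
    (hC.comm _ (mem_kernelsOf.1 hK.prop.1) _ (mem_kernelsOf.1 hL.prop.1)) ?_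
  by_contra hne
  have hmem := hC.exists_inf hK.prop.1 hL.prop.1
  have h1 := hK.le_of_le ⟨hmem, hne⟩ inf_le_left
  have h2 := hL.le_of_le ⟨hmem, hne⟩ inf_le_right
  exact hKL (le_antisymm (h1.trans inf_le_right) (h2.trans inf_le_left))

/-- The projections of `C` have a greatest element. -/
theorem exists_isGreatest (hC : IsCommVonNeumannSubalgebra C) :
    ∃ K, IsGreatest (kernelsOf C) K := by
  have h0 : (⊥ : KSub H) ∈ kernelsOf C := by
    rw [mem_kernelsOf, Submodule.starProjection_bot]
    exact C.zero_mem
  obtain ⟨K, hK, hmax⟩ := WellFounded.has_min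
    (wellFounded_gt (α := Submodule ℂ H)) _ ⟨⊥, h0⟩
  refine ⟨K, hK, fun L hL => ?_⟩
  rw [mem_kernelsOf] at hK hL
  have hcomm := hC.comm _ hK _ hL
  -- For commuting projections this is the projection onto the join, so a maximal `K` is greatest.
  set T := K.starProjection + L.starProjection - K.starProjection * L.starProjection with hT
  have hP : IsStarProjection T :=
    IsStarProjection.add_sub_mul_of_commute hcomm isStarProjection_starProjection
      isStarProjection_starProjection
  obtain ⟨M, hM⟩ := hP.exists_eq_starProjection
  have hKi := (isStarProjection_starProjection (U := K)).isIdempotentElem.eq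
  have hLi := (isStarProjection_starProjection (U := L)).isIdempotentElem.eq
  have hMC : M ∈ kernelsOf C := by
    rw [mem_kernelsOf, ← hM]
    exact C.sub_mem (C.add_mem hK hL) (C.mul_mem hK hL)
  have hKM : K ≤ M := by
    refine Submodule.le_of_starProjection_mul one_ne_zero ?_
    rw [← hM, hT, one_smul, sub_mul, add_mul, mul_assoc, ← hcomm, ← mul_assoc, hKi]
    abel
  have hLM : L ≤ M := by
    refine Submodule.le_of_starProjection_mul one_ne_zero ?_
    rw [← hM, hT, one_smul, sub_mul, add_mul, mul_assoc, hLi]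
    abel
  by_contra hLK
  exact hmax M hMC (lt_of_le_of_ne hKM fun h => hLK (h ▸ hLM))

/-- Every projection of `C` is a combination of atoms, and lies below their supremum. -/
theorem starProjection_mem_span_atoms (K : KSub H)
    (hK : K ∈ kernelsOf C) :
    K.starProjection ∈ Submodule.span ℂ
        ((fun L : KSub H => L.starProjection) '' atomsOf C) ∧ K ≤ sSup (atomsOf C) := by
  induction K using WellFoundedLT.induction with
  | ind K ih =>
    rcases eq_or_ne K ⊥ with rfl | hne
    · rw [Submodule.starProjection_bot]
      exact ⟨Submodule.zero_mem _, bot_le⟩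
    by_cases hat : K ∈ atomsOf C
    · exact ⟨Submodule.subset_span ⟨K, hat, rfl⟩, le_sSup hat⟩
    obtain ⟨L, ⟨hL, hL0⟩, hLK⟩ : ∃ L : KSub H, (L ∈ kernelsOf C ∧ L ≠ ⊥) ∧ L < K := by
      by_contra hcon
      exact hat ⟨⟨hK, hne⟩, fun L hL hLK => by
        by_contra hKL
        exact hcon ⟨L, hL, lt_of_le_not_ge hLK hKL⟩⟩
    -- A nonzero non-atom splits as `L` plus its complement in `K`, both strictly smaller, so
    -- induction applies.
    have hmul := Submodule.starProjection_mul_of_le hLK.le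
    have hP : IsStarProjection (K.starProjection - L.starProjection) :=
      isStarProjection_starProjection.sub_of_mul_eq_right isStarProjection_starProjection hmul
    obtain ⟨M, hM⟩ := hP.exists_eq_starProjection
    have hMC : M ∈ kernelsOf C := by
      rw [mem_kernelsOf, ← hM]
      exact C.sub_mem (mem_kernelsOf.1 hK) (mem_kernelsOf.1 hL)
    have hMle : M ≤ K := by
      refine Submodule.le_of_starProjection_mul one_ne_zero ?_
      rw [← hM, mul_sub, hmul, (isStarProjection_starProjection (U := K)).isIdempotentElem.eq,
        one_smul]
    have hMlt : M < K := by
      refine lt_of_le_of_ne hMle ?_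
      rintro rfl
      exact Submodule.starProjection_ne_zero hL0 (sub_eq_self.1 hM)
    have hsum : K.starProjection = M.starProjection + L.starProjection := by
      rw [← hM, sub_add_cancel]
    obtain ⟨hM1, hM2⟩ := ih M hMlt hMC
    obtain ⟨hL1, hL2⟩ := ih L hLK hL
    refine ⟨hsum ▸ Submodule.add_mem _ hM1 hL1, fun x hx => ?_⟩
    rw [← K.starProjection_eq_self_iff.2 hx, hsum]
    exact Submodule.add_mem _ (hM2 (M.starProjection_apply_mem x))
      (hL2 (L.starProjection_apply_mem x))

/-- `C` is spanned by its projections. -/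
theorem mem_span_kernels (hC : IsCommVonNeumannSubalgebra C) {a : H →L[ℂ] H} (ha : a ∈ C) :
    a ∈ Submodule.span ℂ ((fun L : KSub H => L.starProjection) '' kernelsOf C) := by
  classical
  have hn : IsStarNormal a := ⟨hC.comm _ (star_mem ha) _ ha⟩
  have hcl : IsClosed (C : Set (H →L[ℂ] H)) := isClosed_coe C
  have hfin : (quasispectrum ℂ a).Finite := by
    rw [quasispectrum_eq_spectrum_union_zero]
    rw [← AlgEquiv.spectrum_eq (Module.End.toContinuousLinearMap H).symm a]
    exact (Module.End.finite_spectrum _).union (Set.finite_singleton 0)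
  -- On a finite spectrum indicator functions are continuous, so spectral projections come from the
  -- functional calculus. It requires functions vanishing at `0`, hence the erased point below.
  have hcont : ∀ f : ℂ → ℂ, ContinuousOn f (quasispectrum ℂ a) := fun f => hfin.continuousOn f
  set s : Finset ℂ := hfin.toFinset.erase 0 with hs
  have hdecomp : a = ∑ z ∈ s, z • cfcₙ (fun x : ℂ => if x = z then (1 : ℂ) else 0) a := by
    have h0 : ∀ z ∈ s, z ≠ 0 := fun z hz => Finset.ne_of_mem_erase hz
    conv_lhs => rw [← cfcₙ_id' ℂ a]
    have : ∀ z ∈ s, z • cfcₙ (fun x : ℂ => if x = z then (1 : ℂ) else 0) a =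
        cfcₙ (fun x : ℂ => z • if x = z then (1 : ℂ) else 0) a := fun z hz =>
      (cfcₙ_smul z _ a (hcont _) (by simp [(h0 z hz).symm])).symm
    rw [Finset.sum_congr rfl this, ← cfcₙ_sum _ a s (fun _ _ => hcont _)
      (fun z hz => by simp [(h0 z hz).symm])]
    refine cfcₙ_congr fun x hx => ?_
    by_cases hx0 : x = 0
    · simp [hx0, Finset.sum_apply, hs]
    · have : x ∈ s := Finset.mem_erase.2 ⟨hx0, hfin.mem_toFinset.2 hx⟩
      simp [Finset.sum_apply, this]
  rw [hdecomp]
  refine Submodule.sum_mem _ fun z hz => Submodule.smul_mem _ _ (Submodule.subset_span ?_)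
  have hz0 : z ≠ 0 := Finset.ne_of_mem_erase hz
  have hP : IsStarProjection (cfcₙ (fun x : ℂ => if x = z then (1 : ℂ) else 0) a) := by
    refine ⟨?_, ?_⟩
    · rw [IsIdempotentElem, ← cfcₙ_mul _ _ a (hcont _) (by simp [hz0.symm]) (hcont _)
        (by simp [hz0.symm])]
      congr 1
      ext x
      simp
    · rw [IsSelfAdjoint, ← cfcₙ_star]
      congr 1
      ext x
      split_ifs <;> simp
  obtain ⟨K, hK⟩ := hP.exists_eq_starProjection
  refine ⟨K, ?_, hK.symm⟩
  rw [mem_kernelsOf, ← hK]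
  exact cfcₙ_mem _ ha

theorem mem_iff_mem_span_atoms (hC : IsCommVonNeumannSubalgebra C) {a : H →L[ℂ] H} :
    a ∈ C ↔ a ∈ Submodule.span ℂ ((fun L : KSub H => L.starProjection) '' atomsOf C) := by
  refine ⟨fun ha => ?_, fun ha => ?_⟩
  · refine Submodule.span_le.2 ?_ (hC.mem_span_kernels ha)
    rintro _ ⟨K, hK, rfl⟩
    exact (starProjection_mem_span_atoms K hK).1
  · refine (Submodule.span_le (p := C.toSubmodule)).2 ?_ ha
    rintro _ ⟨K, hK, rfl⟩
    exact mem_kernelsOf.1 (minimal_of_mem_atomsOf hK).prop.1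

theorem one_mem_iff (hC : IsCommVonNeumannSubalgebra C) :
    (1 : H →L[ℂ] H) ∈ C ↔ sSup (atomsOf C) = (⊤ : KSub H) := by
  have htop : (⊤ : KSub H) ∈ kernelsOf C ↔ (1 : H →L[ℂ] H) ∈ C := by
    rw [mem_kernelsOf, Submodule.starProjection_top]
    rfl
  refine ⟨fun h => top_le_iff.1 (starProjection_mem_span_atoms _ (htop.2 h)).2, fun h => ?_⟩
  obtain ⟨K, hK, hle⟩ := hC.exists_isGreatest
  have : K = ⊤ := top_le_iff.1 (h ▸ sSup_le fun L hL => hle (minimal_of_mem_atomsOf hL).prop.1)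
  exact htop.1 (this ▸ hK)

end IsCommVonNeumannSubalgebra

/-- The algebra spanned by the projections on pairwise orthogonal subspaces. -/
noncomputable def spanProjections (S : Set (KSub H)) (hS : S.Pairwise fun K L => K ⟂ L) :
    NonUnitalStarSubalgebra ℂ (H →L[ℂ] H) where
  __ := Submodule.span ℂ ((fun L : KSub H => L.starProjection) '' S)
  mul_mem' {a b} ha hb := by
    change a * b ∈ Submodule.span ℂ ((fun L : KSub H => L.starProjection) '' S)
    have hmul := Submodule.mul_mem_mul ha hb
    rw [Submodule.span_mul_span] at hmul
    refine Submodule.span_le.2 ?_ hmul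
    rintro _ ⟨_, ⟨K, hK, rfl⟩, _, ⟨L, hL, rfl⟩, rfl⟩
    by_cases hKL : K = L
    · subst hKL
      exact Submodule.subset_span ⟨K, hK,
        (isStarProjection_starProjection (U := K)).isIdempotentElem.eq.symm⟩
    · have h0 : K.starProjection * L.starProjection = 0 :=
        (hS hK hL hKL).starProjection_comp_starProjection
      simp only [h0]
      exact Submodule.zero_mem _
  star_mem' {a} ha := by
    change star a ∈ Submodule.span ℂ ((fun L : KSub H => L.starProjection) '' S)
    induction ha using Submodule.span_induction with
    | mem x hx =>
      obtain ⟨K, hK, rfl⟩ := hx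
      rw [(isStarProjection_starProjection (U := K)).isSelfAdjoint.star_eq]
      exact Submodule.subset_span ⟨K, hK, rfl⟩
    | zero => rw [star_zero]; exact Submodule.zero_mem _
    | add x y _ _ hx hy => rw [star_add]; exact Submodule.add_mem _ hx hy
    | smul c x _ hx => rw [star_smul]; exact Submodule.smul_mem _ _ hx

theorem mem_spanProjections {S : Set (KSub H)} {hS : S.Pairwise fun K L => K ⟂ L}
    {a : H →L[ℂ] H} : a ∈ spanProjections S hS ↔
      a ∈ Submodule.span ℂ ((fun L : KSub H => L.starProjection) '' S) :=
  Iff.rfl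

/-- Elements of the span act as scalars on each member of `S`; commutativity and the minimality of
these members follow from this. -/
theorem exists_mul_eq_smul_of_mem_spanProjections {S : Set (KSub H)}
    {hS : S.Pairwise fun K L => K ⟂ L} {a : H →L[ℂ] H} (ha : a ∈ spanProjections S hS)
    {K : KSub H} (hK : K ∈ S) :
    ∃ c : ℂ, a * K.starProjection = c • K.starProjection ∧
      K.starProjection * a = c • K.starProjection := by
  rw [mem_spanProjections] at ha
  induction ha using Submodule.span_induction with
  | mem x hx =>
    obtain ⟨L, hL, rfl⟩ := hx
    by_cases hKL : K = L
    · subst hKL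
      refine ⟨1, ?_⟩
      simp [(isStarProjection_starProjection (U := K)).isIdempotentElem.eq]
    · refine ⟨0, ?_⟩
      rw [zero_smul]
      exact ⟨(hS hL hK (Ne.symm hKL)).starProjection_comp_starProjection,
        (hS hK hL hKL).starProjection_comp_starProjection⟩
  | zero => exact ⟨0, by simp⟩
  | add x y _ _ hx hy =>
    obtain ⟨c, hc, hc'⟩ := hx
    obtain ⟨d, hd, hd'⟩ := hy
    exact ⟨c + d, by rw [add_mul, hc, hd, add_smul], by rw [mul_add, hc', hd', add_smul]⟩
  | smul r x _ hx =>
    obtain ⟨c, hc, hc'⟩ := hx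
    exact ⟨r * c, by rw [smul_mul_assoc, hc, mul_smul], by rw [mul_smul_comm, hc', mul_smul]⟩

theorem isCommVonNeumannSubalgebra_spanProjections (S : Set (KSub H))
    (hS : S.Pairwise fun K L => K ⟂ L) :
    IsCommVonNeumannSubalgebra (spanProjections S hS) where
  comm a ha b hb := by
    rw [mem_spanProjections] at hb
    induction hb using Submodule.span_induction with
    | mem x hx =>
      obtain ⟨K, hK, rfl⟩ := hx
      obtain ⟨c, hc, hc'⟩ := exists_mul_eq_smul_of_mem_spanProjections ha hK
      rw [hc, hc']
    | zero => simp
    | add x y _ _ hx hy => rw [mul_add, add_mul, hx, hy]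
    | smul r x _ hx => rw [smul_mul_assoc, mul_smul_comm, hx]
  closed := by
    have : FiniteDimensional ℂ (H →WOT[ℂ] H) :=
      Module.Finite.equiv (ContinuousLinearMapWOT.linearEquiv ℂ).symm
    exact ((spanProjections S hS).toSubmodule.comap
      (ContinuousLinearMapWOT.linearEquiv ℂ).toLinearMap).closed_of_finiteDimensional

theorem atomsOf_spanProjections {S : Set (KSub H)} (hS : S.Pairwise fun K L => K ⟂ L)
    (hne : ∀ K ∈ S, K ≠ ⊥) : atomsOf (spanProjections S hS) = S := by
  have hmin : S ⊆ atomsOf (spanProjections S hS) := fun K hK => by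
    refine ⟨⟨mem_kernelsOf.2 (Submodule.subset_span ⟨K, hK, rfl⟩), hne K hK⟩, ?_⟩
    rintro L ⟨hL, hL0⟩ hLK
    obtain ⟨c, hc, hc'⟩ := exists_mul_eq_smul_of_mem_spanProjections (mem_kernelsOf.1 hL) hK
    refine Submodule.le_of_starProjection_mul (c := c) ?_ hc
    -- If `c = 0`, then `L ≤ K` gives `P(L) = P(K) P(L) = 0`.
    rintro rfl
    rw [Submodule.starProjection_mul_of_le hLK, zero_smul] at hc'
    exact Submodule.starProjection_ne_zero hL0 hc'
  refine (Set.Subset.antisymm hmin fun L hL => ?_).symm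
  replace hL := minimal_of_mem_atomsOf hL
  have hLC := mem_kernelsOf.1 hL.prop.1
  by_cases hex : ∃ K ∈ S, K ≤ L
  · obtain ⟨K, hK, hKL⟩ := hex
    have := hL.le_of_le (minimal_of_mem_atomsOf (hmin hK)).prop hKL
    rwa [le_antisymm this hKL]
  · exfalso
    -- A nonzero scalar would put a member of `S` below `L`. So `P(L)` annihilates every generator,
    -- hence the whole algebra and in particular itself.
    have h0 : ∀ a ∈ spanProjections S hS, L.starProjection * a = 0 := fun a ha => by
      rw [mem_spanProjections] at ha
      induction ha using Submodule.span_induction with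
      | mem x hx =>
        obtain ⟨K, hK, rfl⟩ := hx
        obtain ⟨c, hc, -⟩ := exists_mul_eq_smul_of_mem_spanProjections hLC hK
        rcases eq_or_ne c 0 with rfl | hc0
        · rw [hc, zero_smul]
        · exact absurd ⟨K, hK, Submodule.le_of_starProjection_mul hc0 hc⟩ hex
      | zero => simp
      | add x y _ _ hx hy => rw [mul_add, hx, hy, add_zero]
      | smul r x _ hx => rw [mul_smul_comm, hx, smul_zero]
    have := h0 _ hLC
    rw [(isStarProjection_starProjection (U := L)).isIdempotentElem.eq] at this
    exact Submodule.starProjection_ne_zero hL.prop.2 this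

end Algebra

theorem mainTheorem6 {H : Type*} [NormedAddCommGroup H] [InnerProductSpace ℂ H]
    [CompleteSpace H] [FiniteDimensional ℂ H] :
    Set.BijOn (atomsOf (H := H))
      {C : NonUnitalStarSubalgebra ℂ (H →L[ℂ] H) | IsCommVonNeumannSubalgebra C}
      {S : Set (KSub H) | IsCopyableKernelFamily (fun K : S => (K : KSub H))} ∧
    ∀ C : NonUnitalStarSubalgebra ℂ (H →L[ℂ] H), IsCommVonNeumannSubalgebra C →
      ((1 : H →L[ℂ] H) ∈ C ↔ sSup (atomsOf C) = (⊤ : KSub H)) := by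
  refine ⟨⟨fun C hC => ?_, fun C hC D hD h => ?_, fun S hS => ?_⟩, fun C hC => hC.one_mem_iff⟩
  · exact isCopyableKernelFamily_of_pairwise_isOrtho (fun K hK => (minimal_of_mem_atomsOf hK).prop.2) hC.atoms_isOrtho
  · ext a
    rw [hC.mem_iff_mem_span_atoms, hD.mem_iff_mem_span_atoms, h]
  · have hort : S.Pairwise fun K L => K ⟂ L := fun K hK L hL hKL =>
      hS.isOrtho (i := ⟨K, hK⟩) (j := ⟨L, hL⟩) fun h => hKL (congrArg Subtype.val h)
    exact ⟨spanProjections S hort, isCommVonNeumannSubalgebra_spanProjections S hort,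
      atomsOf_spanProjections hort fun K hK => hS.ne_bot ⟨K, hK⟩⟩
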